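/- Let $X$ be a measurable space, and let $d_{\mathrm{TV}}(p,q)=\sup_E|p(E)-q(E)|$ be the total variation distance between probability distributions on $X$. A randomized learner $A$ assigns to each sample $S\in X^n$, for each $n\in\mathbb N$, a random probability distribution $A(S)$ on $X$ (its law depends measurably on $S$; the set of distributions carries the smallest $\sigma$-algebra for which all maps $q\mapsto q(E)$ and $q\mapsto d_{\mathrm{TV}}(p,q)$ are measurable). On samples of size $n$, $A$ is $(\varepsilon,0)$-differentially private (DP) if $\Pr[A(x)\in B]\le e^{\varepsilon}\Pr[A(x')\in B]$ for all measurable sets $B$ of distributions and all $x,x'\in X^n$ that differ in one entry. A nonempty class $\mathcal Q$ of probability distributions on $X$ is *pure DP learnable* if there are a randomized learner $A$ and a function $n_{\mathcal Q}:(0,1)^3\to\mathbb N$ such that for every $p\in\mathcal Q$, every $(\alpha,\beta,\varepsilon)\in(0,1)^3$ and every $n\ge n_{\mathcal Q}(\alpha,\beta,\varepsilon)$: (1) $A$ is $(\varepsilon,0)$-DP on samples of size $n$; and (2) with probability at least $1-\beta$ over a sample $S$ of $n$ i.i.d. draws from $p$ and over the randomness of $A$, $d_{\mathrm{TV}}(p,A(S))\le\alpha$.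 The class $\mathcal Q$ is *pure DP $c$-robustly learnable* if there are a randomized learner $A$ and a function $n_{\mathcal Q}:(0,1)^3\to\mathbb N$ such that for every probability distribution $p$ on $X$ (not necessarily in $\mathcal Q$), every $(\alpha,\beta,\varepsilon)\in(0,1)^3$ and every $n\ge n_{\mathcal Q}(\alpha,\beta,\varepsilon)$, (1) holds, and (2) holds with the bound replaced by $d_{\mathrm{TV}}(p,A(S))\le c\cdot\inf_{p'\in\mathcal Q}d_{\mathrm{TV}}(p,p')+\alpha$. **Theorem.** If a nonempty class $\mathcal Q$ of probability distributions on $X$ is pure DP learnable, then $\mathcal Q$ is pure DP $3$-robustly learnable. -/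

import Mathlib

open MeasureTheory ProbabilityTheory

noncomputable section

namespace DPRobust

/-- A probability distribution on the measurable space `X`. -/
def Distribution (X : Type*) [MeasurableSpace X] : Type _ :=
  {p : Measure X // IsProbabilityMeasure p}

variable {X : Type*} [MeasurableSpace X]

/-- Total variation distance, `sup_E |p(E) - q(E)|` over the measurable sets `E`. -/
def tvDist (p q : Distribution X) : ℝ :=
  ⨆ E : {E : Set X // MeasurableSet E}, |p.1.real E.1 - q.1.real E.1|

/-- Total variation distance from `p` to a class: `inf_{p' ∈ Q} d_TV(p, p')`. -/
def tvDistTo (p : Distribution X) (Q : Set (Distribution X)) : ℝ :=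
  ⨅ p' : Q, tvDist p p'.1

/-- The output space of a learner carries the smallest σ-algebra for which every evaluation
`q ↦ q E` (`E` measurable) and every distance function `q ↦ d_TV(p, q)` is measurable.
The distances are already measurable for the evaluations if the σ-algebra of `X` is
countably generated; adding them makes "`d_TV(p, A(S)) ≤ α`" an event over every `X`. -/
instance : MeasurableSpace (Distribution X) :=
  (⨆ E : {E : Set X // MeasurableSet E},
      MeasurableSpace.comap (fun q : Distribution X => q.1 E.1) inferInstance) ⊔
    (⨆ p : Distribution X, MeasurableSpace.comap (fun q => tvDist p q) inferInstance)

theorem measurable_tvDist (p : Distribution X) : Measurable (fun q => tvDist p q) :=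
  Measurable.mono (comap_measurable _)
    (le_sup_of_le_right
      (le_iSup (fun p : Distribution X =>
        MeasurableSpace.comap (fun q => tvDist p q) inferInstance) p)) le_rfl

variable (X) in
/-- A randomized learner: for every sample size `n`, a Markov kernel that sends a sample
`S ∈ X^n` to the law of the (random) distribution `A(S)`. -/
structure RandomizedLearner where
  toKernel : (n : ℕ) → Kernel (Fin n → X) (Distribution X)
  isMarkov : ∀ n, IsMarkovKernel (toKernel n)

/-- `x` and `x'` differ in (at most) one entry. -/
def Neighbors {n : ℕ} (x x' : Fin n → X) : Prop :=
  ∃ i, ∀ j, j ≠ i → x j = x' j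

/-- `(ε, δ)`-differential privacy of a randomized map on samples of size `n`. -/
def IsDP {n : ℕ} {Y : Type*} [MeasurableSpace Y] (K : Kernel (Fin n → X) Y) (ε δ : ℝ) : Prop :=
  ∀ x x' : Fin n → X, Neighbors x x' → ∀ B : Set Y, MeasurableSet B →
    K x B ≤ ENNReal.ofReal (Real.exp ε) * K x' B + ENNReal.ofReal δ

/-- The law of `A(S)` where `S` consists of `n` i.i.d. samples from `p`: the randomness is
that of the sample and that of the learner. -/
def outputLaw (A : RandomizedLearner X) (n : ℕ) (p : Distribution X) :
    Measure (Distribution X) :=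
  haveI := p.2
  (Measure.pi fun _ : Fin n => p.1).bind (A.toKernel n)

/-- `Q` is pure DP learnable. -/
def PureDPLearnable (Q : Set (Distribution X)) : Prop :=
  ∃ (A : RandomizedLearner X) (N : ℝ → ℝ → ℝ → ℕ),
    ∀ p ∈ Q, ∀ α ∈ Set.Ioo (0 : ℝ) 1, ∀ β ∈ Set.Ioo (0 : ℝ) 1, ∀ ε ∈ Set.Ioo (0 : ℝ) 1,
      ∀ n ≥ N α β ε,
        IsDP (A.toKernel n) ε 0 ∧
        ENNReal.ofReal (1 - β) ≤ outputLaw A n p {q | tvDist p q ≤ α}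

/-- `Q` is pure DP `c`-robustly learnable: as above, but `p` is an arbitrary distribution and
the error allowed is `c * d_TV(p, Q) + α`. -/
def PureDPRobustlyLearnable (c : ℝ) (Q : Set (Distribution X)) : Prop :=
  ∃ (A : RandomizedLearner X) (N : ℝ → ℝ → ℝ → ℕ),
    ∀ p : Distribution X,
      ∀ α ∈ Set.Ioo (0 : ℝ) 1, ∀ β ∈ Set.Ioo (0 : ℝ) 1, ∀ ε ∈ Set.Ioo (0 : ℝ) 1,
      ∀ n ≥ N α β ε,
        IsDP (A.toKernel n) ε 0 ∧
        ENNReal.ofReal (1 - β) ≤ outputLaw A n p {q | tvDist p q ≤ c * tvDistTo p Q + α}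

end DPRobust

end

open MeasureTheory ProbabilityTheory

noncomputable section

namespace DPRobust

variable {X : Type*} [MeasurableSpace X]

/-! ### Total variation distance -/

/-! Pure privacy makes the laws of the output on any two samples of size `n` comparable up to `exp ε
^ n` (`IsDP.group`). So, on one fixed sample, a learner for `Q` must charge a small ball around
every member of `Q` with mass bounded below. Disjoint balls share total mass one, so separated
families in `Q` are bounded in size (`card_le_of_separated`), and a maximal one is a finite cover
(`PureDPLearnable.exists_finset_cover`). The robust learner uses only this cover. It runs the
exponential mechanism with score the worst error of a candidate on near-Scheffé sets of pairs of
candidates, measured against empirical frequencies. Minimum distance estimation gives the factor 3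
for every `p` (`tvDist_le_of_discrepancy_le`). Finitely many sets and candidates make both failure
probabilities vanish as `n` grows (`exists_isRobustAt`); a diagonal choice of accuracy then gives
one learner for all parameters. -/

lemma abs_sub_le_one (p q : Distribution X) (E : Set X) :
    |p.1.real E - q.1.real E| ≤ 1 := by
  have := p.2
  have := q.2
  have h1 : p.1.real E ≤ 1 := measureReal_le_one
  have h2 : q.1.real E ≤ 1 := measureReal_le_one
  have h3 : 0 ≤ p.1.real E := measureReal_nonneg
  have h4 : 0 ≤ q.1.real E := measureReal_nonneg
  rw [abs_le]
  constructor <;> linarith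

lemma abs_sub_le_tvDist (p q : Distribution X) {E : Set X} (hE : MeasurableSet E) :
    |p.1.real E - q.1.real E| ≤ tvDist p q :=
  le_ciSup (f := fun E : {E : Set X // MeasurableSet E} => |p.1.real E.1 - q.1.real E.1|)
    ⟨1, by rintro _ ⟨E, rfl⟩; exact abs_sub_le_one p q E.1⟩ ⟨E, hE⟩

lemma tvDist_le {p q : Distribution X} {a : ℝ}
    (h : ∀ E, MeasurableSet E → |p.1.real E - q.1.real E| ≤ a) : tvDist p q ≤ a :=
  haveI : Nonempty {E : Set X // MeasurableSet E} := ⟨⟨∅, .empty⟩⟩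
  ciSup_le fun E => h E.1 E.2

lemma tvDist_nonneg (p q : Distribution X) : 0 ≤ tvDist p q :=
  (abs_nonneg _).trans (abs_sub_le_tvDist p q MeasurableSet.empty)

lemma tvDist_self (p : Distribution X) : tvDist p p = 0 :=
  le_antisymm (tvDist_le fun E _ => by simp) (tvDist_nonneg p p)

lemma tvDist_comm (p q : Distribution X) : tvDist p q = tvDist q p := by
  unfold tvDist
  simp only [abs_sub_comm]

lemma tvDist_triangle (p q r : Distribution X) : tvDist p r ≤ tvDist p q + tvDist q r :=
  tvDist_le fun _ hE => (abs_sub_le _ _ _).trans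
    (add_le_add (abs_sub_le_tvDist p q hE) (abs_sub_le_tvDist q r hE))

/-- Scheffé sets exist up to an arbitrarily small error. -/
lemma exists_tvDist_le_add (p q : Distribution X) {η : ℝ} (hη : 0 < η) :
    ∃ E, MeasurableSet E ∧ tvDist p q ≤ |p.1.real E - q.1.real E| + η := by
  by_contra! h
  have := tvDist_le (p := p) (q := q) (a := tvDist p q - η)
    fun E hE => by linarith [h E hE]
  linarith

lemma exists_tvDist_lt_tvDistTo_add {Q : Set (Distribution X)} (hQ : Q.Nonempty)
    (p : Distribution X) {η : ℝ} (hη : 0 < η) :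
    ∃ q ∈ Q, tvDist p q < tvDistTo p Q + η := by
  have := hQ.to_subtype
  obtain ⟨q, hq⟩ := exists_lt_of_ciInf_lt
    (show (⨅ p' : Q, tvDist p p'.1) < tvDistTo p Q + η from lt_add_of_pos_right _ hη)
  exact ⟨q.1, q.2, hq⟩

lemma measurableSet_tvDist_le (p : Distribution X) (a : ℝ) :
    MeasurableSet {q | tvDist p q ≤ a} :=
  measurableSet_le (measurable_tvDist p) measurable_const

/-! ### Group privacy and finite covers -/

/-- Replace the entries of `x` by those of `x'` one at a time; each hybrid costs a factor `exp ε`.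
-/
lemma IsDP.group {n : ℕ} {Y : Type*} [MeasurableSpace Y] {K : Kernel (Fin n → X) Y} {ε : ℝ}
    (hK : IsDP K ε 0) (x x' : Fin n → X) {B : Set Y} (hB : MeasurableSet B) :
    K x B ≤ ENNReal.ofReal (Real.exp ε) ^ n * K x' B := by
  have key : ∀ k ≤ n, K x B ≤ ENNReal.ofReal (Real.exp ε) ^ k *
      K (fun i => if i.1 < k then x' i else x i) B := by
    intro k
    induction k with
    | zero => intro _; simp
    | succ k ih =>
      intro hk
      refine (ih (by omega)).trans ?_
      rw [pow_succ, mul_assoc]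
      gcongr
      have := hK (fun i => if i.1 < k then x' i else x i)
        (fun i => if i.1 < k + 1 then x' i else x i)
        ⟨⟨k, hk⟩, fun j hj => by
          have : j.1 ≠ k := fun h => hj (Fin.ext h)
          have h2 : j.1 < k + 1 ↔ j.1 < k := by omega
          simp only [h2]⟩ B hB
      simpa using this
  simpa using key n le_rfl

lemma outputLaw_apply (A : RandomizedLearner X) (n : ℕ) (p : Distribution X)
    {B : Set (Distribution X)} (hB : MeasurableSet B) :
    outputLaw A n p B =
      haveI := p.2
      ∫⁻ x, A.toKernel n x B ∂(Measure.pi fun _ : Fin n => p.1) := by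
  unfold outputLaw
  exact Measure.bind_apply hB (A.toKernel n).aemeasurable

/-- A private learner on `n` samples limits the size of separated families. -/
lemma card_le_of_separated {A : RandomizedLearner X} {n : ℕ} {ε α β : ℝ}
    (hA : IsDP (A.toKernel n) ε 0) (hβ : β < 1) {T : Finset (Distribution X)}
    (hacc : ∀ p ∈ T, ENNReal.ofReal (1 - β) ≤ outputLaw A n p {q | tvDist p q ≤ α})
    (hsep : ∀ p ∈ T, ∀ q ∈ T, p ≠ q → 2 * α < tvDist p q) :
    (T.card : ℝ) ≤ Real.exp ε ^ n / (1 - β) := by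
  rcases T.eq_empty_or_nonempty with rfl | ⟨p₀, -⟩
  · simp only [Finset.card_empty, Nat.cast_zero]
    have : 0 < 1 - β := by linarith
    positivity
  have := A.isMarkov n
  have := p₀.2
  obtain ⟨z⟩ := nonempty_of_isProbabilityMeasure p₀.1
  -- Any sample would do: group privacy transfers accuracy under each `p` to this single reference
  -- point.
  let x₀ : Fin n → X := fun _ => z
  have hball : ∀ p ∈ T, ENNReal.ofReal (1 - β) ≤
      ENNReal.ofReal (Real.exp ε) ^ n * A.toKernel n x₀ {q | tvDist p q ≤ α} := by
    intro p hp
    have := p.2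
    refine (hacc p hp).trans ?_
    rw [outputLaw_apply _ _ _ (measurableSet_tvDist_le p α)]
    calc _ ≤ ∫⁻ _, ENNReal.ofReal (Real.exp ε) ^ n * A.toKernel n x₀ {q | tvDist p q ≤ α}
          ∂(Measure.pi fun _ : Fin n => p.1) :=
          lintegral_mono fun x => hA.group x x₀ (measurableSet_tvDist_le p α)
      _ = _ := by simp
  have hdisj : ∑ p ∈ T, A.toKernel n x₀ {q | tvDist p q ≤ α} ≤ 1 := by
    rw [← measure_biUnion_finset _ fun p _ => measurableSet_tvDist_le p α]
    · exact prob_le_one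
    · intro p hp q hq hpq
      refine Set.disjoint_left.2 fun r hr hr' => ?_
      have h1 : tvDist p r ≤ α := hr
      have h2 : tvDist q r ≤ α := hr'
      have h3 := tvDist_triangle p r q
      rw [tvDist_comm r q] at h3
      linarith [hsep p hp q hq hpq]
  have hsum : (T.card : ENNReal) * ENNReal.ofReal (1 - β) ≤
      ENNReal.ofReal (Real.exp ε) ^ n := by
    calc (T.card : ENNReal) * ENNReal.ofReal (1 - β)
        = ∑ _p ∈ T, ENNReal.ofReal (1 - β) := by simp
      _ ≤ ∑ p ∈ T, ENNReal.ofReal (Real.exp ε) ^ n * A.toKernel n x₀ {q | tvDist p q ≤ α} :=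
          Finset.sum_le_sum hball
      _ = ENNReal.ofReal (Real.exp ε) ^ n * ∑ p ∈ T, A.toKernel n x₀ {q | tvDist p q ≤ α} := by
          rw [Finset.mul_sum]
      _ ≤ ENNReal.ofReal (Real.exp ε) ^ n * 1 := by gcongr
      _ = _ := mul_one _
  rw [le_div_iff₀ (by linarith)]
  rw [← ENNReal.ofReal_pow (Real.exp_pos _).le, ← ENNReal.ofReal_natCast,
    ← ENNReal.ofReal_mul (by positivity)] at hsum
  exact (ENNReal.ofReal_le_ofReal_iff (by positivity)).1 hsum

/-- A pure DP learnable class is totally bounded in total variation. -/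
lemma PureDPLearnable.exists_finset_cover {Q : Set (Distribution X)} (h : PureDPLearnable Q)
    {r : ℝ} (hr : r ∈ Set.Ioo (0 : ℝ) 1) :
    ∃ T : Finset (Distribution X), ∀ p ∈ Q, ∃ q ∈ T, tvDist p q ≤ r := by
  classical
  obtain ⟨A, N, hA⟩ := h
  have hα : r / 2 ∈ Set.Ioo (0 : ℝ) 1 := ⟨by linarith [hr.1], by linarith [hr.1, hr.2]⟩
  have hhalf : (1 / 2 : ℝ) ∈ Set.Ioo (0 : ℝ) 1 := by norm_num
  set n := N (r / 2) (1 / 2) (1 / 2)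
  let Sep : ℕ → Prop := fun m => ∃ T : Finset (Distribution X), ↑T ⊆ Q ∧ T.card = m ∧
    ∀ p ∈ T, ∀ q ∈ T, p ≠ q → r < tvDist p q
  obtain ⟨b, hb⟩ := exists_nat_ge (Real.exp (1 / 2) ^ n / (1 - 1 / 2))
  have hbound : ∀ m, Sep m → m ≤ b := by
    rintro m ⟨T, hTQ, rfl, hT⟩
    rcases T.eq_empty_or_nonempty with rfl | ⟨p₀, hp₀⟩
    · simp
    have hA' := fun p hp => hA p (hTQ hp) _ hα _ hhalf _ hhalf n le_rfl
    have := card_le_of_separated (hA' p₀ hp₀).1 hhalf.2 (fun p hp => (hA' p hp).2)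
      (fun p hp q hq hpq => by linarith [hT p hp q hq hpq])
    exact_mod_cast this.trans hb
  have h0 : Sep 0 := ⟨∅, by simp, by simp, by simp⟩
  -- A separated family of maximal size covers `Q`, since an uncovered point could be added to it.
  obtain ⟨T, hTQ, hcard, hT⟩ := Nat.findGreatest_spec (P := Sep) (Nat.zero_le b) h0
  refine ⟨T, fun p hp => ?_⟩
  by_contra! hfar
  have hpT : p ∉ T := fun h => by linarith [hfar p h, tvDist_self p, hr.1]
  have hS : Sep (T.card + 1) := by
    refine ⟨insert p T, ?_, Finset.card_insert_of_notMem hpT, ?_⟩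
    · rw [Finset.coe_insert]
      exact Set.insert_subset hp hTQ
    · intro q hq q' hq' hne
      rcases Finset.mem_insert.1 hq with rfl | hqT <;>
        rcases Finset.mem_insert.1 hq' with rfl | hqT'
      · exact absurd rfl hne
      · exact hfar q' hqT'
      · rw [tvDist_comm]
        exact hfar q hqT
      · exact hT q hqT q' hqT' hne
  have := Nat.le_findGreatest (hbound _ hS) hS
  omega

/-! ### The exponential mechanism -/

section ExpMechanism

variable {Ω Y ι : Type*} [MeasurableSpace Ω] [MeasurableSpace Y] [Fintype ι]

/-- The probabilities proportional to `exp (-s i)`. -/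
def gibbs (s : ι → ℝ) (i : ι) : ℝ := Real.exp (-s i) / ∑ j, Real.exp (-s j)

lemma sum_exp_pos [Nonempty ι] (s : ι → ℝ) : 0 < ∑ j, Real.exp (-s j) :=
  Finset.sum_pos (fun _ _ => Real.exp_pos _) Finset.univ_nonempty

lemma gibbs_nonneg (s : ι → ℝ) (i : ι) : 0 ≤ gibbs s i := by
  unfold gibbs
  positivity

lemma sum_gibbs [Nonempty ι] (s : ι → ℝ) : ∑ i, gibbs s i = 1 := by
  unfold gibbs
  rw [← Finset.sum_div]
  exact div_self (sum_exp_pos s).ne'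

/-- The weight and the normaliser each contribute a factor `exp c`. -/
lemma gibbs_le_exp_mul [Nonempty ι] {s s' : ι → ℝ} {c : ℝ} (h : ∀ i, |s i - s' i| ≤ c) (i : ι) :
    gibbs s i ≤ Real.exp (2 * c) * gibbs s' i := by
  have hle : ∀ i, Real.exp (-s i) ≤ Real.exp c * Real.exp (-s' i) := fun i => by
    rw [← Real.exp_add]
    exact Real.exp_le_exp.2 (by linarith [(abs_le.1 (h i)).1])
  have hge : ∑ j, Real.exp (-s' j) ≤ Real.exp c * ∑ j, Real.exp (-s j) := by
    rw [Finset.mul_sum]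
    refine Finset.sum_le_sum fun j _ => ?_
    rw [← Real.exp_add]
    exact Real.exp_le_exp.2 (by linarith [(abs_le.1 (h j)).2])
  unfold gibbs
  rw [mul_div_assoc', div_le_div_iff₀ (sum_exp_pos s) (sum_exp_pos s'), two_mul, Real.exp_add]
  calc _ ≤ (Real.exp c * Real.exp (-s' i)) * (Real.exp c * ∑ j, Real.exp (-s j)) :=
        mul_le_mul (hle i) hge (sum_exp_pos s').le (by positivity)
    _ = _ := by ring

lemma gibbs_le_exp_neg {s : ι → ℝ} {i i₀ : ι} {a : ℝ} (h : s i₀ + a ≤ s i) :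
    gibbs s i ≤ Real.exp (-a) := by
  have : Real.exp (-s i₀) ≤ ∑ j, Real.exp (-s j) :=
    Finset.single_le_sum (f := fun j => Real.exp (-s j)) (fun _ _ => (Real.exp_pos _).le)
      (Finset.mem_univ i₀)
  unfold gibbs
  rw [div_le_iff₀ ((Real.exp_pos _).trans_le this)]
  calc _ ≤ Real.exp (-a) * Real.exp (-s i₀) := by
        rw [← Real.exp_add]
        exact Real.exp_le_exp.2 (by linarith)
    _ ≤ _ := by gcongr

/-- The exponential mechanism: output `y i` with probability proportional to `exp (-s i x)`. -/
def expMechanism (s : ι → Ω → ℝ) (hs : ∀ i, Measurable (s i)) (y : ι → Y) : Kernel Ω Y where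
  toFun x := ∑ i, ENNReal.ofReal (gibbs (fun j => s j x) i) • Measure.dirac (y i)
  measurable' := by
    refine Measure.measurable_of_measurable_coe _ fun B _ => ?_
    simp only [Measure.finsetSum_apply, Measure.smul_apply, smul_eq_mul]
    unfold gibbs
    fun_prop

lemma expMechanism_apply (s : ι → Ω → ℝ) (hs : ∀ i, Measurable (s i)) (y : ι → Y) (x : Ω)
    (B : Set Y) : expMechanism s hs y x B =
      ∑ i, ENNReal.ofReal (gibbs (fun j => s j x) i) * Measure.dirac (y i) B := by
  simp [expMechanism]

lemma isMarkovKernel_expMechanism [Nonempty ι] (s : ι → Ω → ℝ) (hs : ∀ i, Measurable (s i))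
    (y : ι → Y) : IsMarkovKernel (expMechanism s hs y) := by
  refine ⟨fun x => ⟨?_⟩⟩
  rw [expMechanism_apply]
  simp only [measure_univ, mul_one]
  rw [← ENNReal.ofReal_sum_of_nonneg fun i _ => gibbs_nonneg _ i, sum_gibbs, ENNReal.ofReal_one]

lemma isDP_expMechanism [Nonempty ι] {n : ℕ} {s : ι → (Fin n → X) → ℝ}
    (hs : ∀ i, Measurable (s i)) (y : ι → Y) {ε : ℝ}
    (h : ∀ x x', Neighbors x x' → ∀ i, |s i x - s i x'| ≤ ε / 2) :
    IsDP (expMechanism s hs y) ε 0 := by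
  intro x x' hx B _
  rw [ENNReal.ofReal_zero, add_zero, expMechanism_apply, expMechanism_apply, Finset.mul_sum]
  refine Finset.sum_le_sum fun i _ => ?_
  rw [← mul_assoc, ← ENNReal.ofReal_mul (Real.exp_pos _).le]
  gcongr
  have := gibbs_le_exp_mul (h x x' hx) i
  rwa [mul_div_cancel₀ _ two_ne_zero] at this

/-- Outcomes whose score is within `a` of that of `i₀` carry almost all the mass. -/
lemma le_expMechanism_apply [Nonempty ι] {s : ι → Ω → ℝ} (hs : ∀ i, Measurable (s i)) (y : ι → Y)
    {x : Ω} {B : Set Y} (hB : MeasurableSet B) {i₀ : ι} {a : ℝ}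
    (h : ∀ i, y i ∈ B ∨ s i₀ x + a ≤ s i x) :
    ENNReal.ofReal (1 - Fintype.card ι * Real.exp (-a)) ≤ expMechanism s hs y x B := by
  have := isMarkovKernel_expMechanism s hs y
  have hcompl : expMechanism s hs y x Bᶜ ≤ ENNReal.ofReal (Fintype.card ι * Real.exp (-a)) := by
    rw [expMechanism_apply]
    calc _ ≤ ∑ _i : ι, ENNReal.ofReal (Real.exp (-a)) := by
          refine Finset.sum_le_sum fun i _ => ?_
          rcases h i with hi | hi
          · rw [Measure.dirac_apply' _ hB.compl]
            simp [hi]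
          · refine (mul_le_of_le_one_right' prob_le_one).trans ?_
            exact ENNReal.ofReal_le_ofReal (gibbs_le_exp_neg (s := fun j => s j x) hi)
      _ = _ := by
          rw [ENNReal.ofReal_mul (by positivity)]
          simp
  rw [ENNReal.ofReal_sub _ (by positivity), ENNReal.ofReal_one, tsub_le_iff_right]
  calc (1 : ENNReal) = expMechanism s hs y x B + expMechanism s hs y x Bᶜ := by
        rw [measure_add_measure_compl hB, measure_univ]
    _ ≤ _ := by gcongr

end ExpMechanism

/-! ### Empirical frequencies -/

/-- The fraction of the sample `x` that lies in `S`. -/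
def empFreq {n : ℕ} (S : Set X) (x : Fin n → X) : ℝ :=
  (∑ i, S.indicator (fun _ => (1 : ℝ)) (x i)) / n

lemma measurable_empFreq {n : ℕ} {S : Set X} (hS : MeasurableSet S) :
    Measurable (empFreq (n := n) S) := by
  have : Measurable (S.indicator fun _ => (1 : ℝ)) := measurable_const.indicator hS
  unfold empFreq
  fun_prop

lemma Neighbors.abs_empFreq_sub_le {X : Type*} {n : ℕ} {x x' : Fin n → X} (h : Neighbors x x')
    (S : Set X) :
    |empFreq S x - empFreq S x'| ≤ 1 / n := by
  obtain ⟨i, hi⟩ := h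
  unfold empFreq
  rw [← sub_div, abs_div, Nat.abs_cast, ← Finset.sum_sub_distrib,
    Finset.sum_eq_single i (fun j _ hj => by rw [hi j hj, sub_self]) (by simp)]
  gcongr
  by_cases h1 : x i ∈ S <;> by_cases h2 : x' i ∈ S <;> simp [h1, h2]

/-- Chebyshev's inequality for the empirical frequency. -/
lemma measure_empFreq_deviation_le (p : Distribution X) {n : ℕ} (hn : 0 < n) {S : Set X}
    (hS : MeasurableSet S) {η : ℝ} (hη : 0 < η) :
    haveI := p.2
    (Measure.pi fun _ : Fin n => p.1) {x | η ≤ |p.1.real S - empFreq S x|} ≤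
      ENNReal.ofReal (1 / (n * η ^ 2)) := by
  have := p.2
  have hn' : (0 : ℝ) < n := by exact_mod_cast hn
  have hmeas : Measurable (S.indicator fun _ => (1 : ℝ)) := measurable_const.indicator hS
  have hbdd : ∀ y, S.indicator (fun _ => (1 : ℝ)) y ∈ Set.Icc (0 : ℝ) 1 := fun y => by
    by_cases h : y ∈ S <;> simp [h]
  have hL : MemLp (S.indicator fun _ => (1 : ℝ)) 2 p.1 :=
    memLp_indicator_const 2 hS 1 (Or.inr (measure_ne_top _ _))
  set Z : (Fin n → X) → ℝ := ∑ i, fun x => S.indicator (fun _ => (1 : ℝ)) (x i) with hZ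
  have hZapp : ∀ x, Z x = ∑ i, S.indicator (fun _ => (1 : ℝ)) (x i) := fun x => by
    simp [hZ]
  have hLi : ∀ i : Fin n, MemLp (fun x : Fin n → X => S.indicator (fun _ => (1 : ℝ)) (x i)) 2
      (Measure.pi fun _ : Fin n => p.1) := fun i =>
    hL.comp_measurePreserving (measurePreserving_eval (fun _ : Fin n => p.1) i)
  have hZL : MemLp Z 2 (Measure.pi fun _ : Fin n => p.1) := memLp_finsetSum' _ fun i _ => hLi i
  have hmean : ∫ x, Z x ∂(Measure.pi fun _ : Fin n => p.1) = n * p.1.real S := by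
    simp_rw [hZapp]
    rw [integral_finsetSum _ fun i _ => (hLi i).integrable (by norm_num)]
    have : ∀ i : Fin n, ∫ x : Fin n → X, S.indicator (fun _ => (1 : ℝ)) (x i)
        ∂(Measure.pi fun _ : Fin n => p.1) = p.1.real S := fun i => by
      rw [integral_comp_eval (μ := fun _ : Fin n => p.1) hmeas.aestronglyMeasurable,
        integral_indicator_const _ hS, smul_eq_mul, mul_one]
    simp [this]
  -- Each indicator has variance at most 1/4; the cruder bound 1 suffices.
  have hvar : variance Z (Measure.pi fun _ : Fin n => p.1) ≤ n := by
    rw [hZ, variance_sum_pi fun _ => hL]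
    calc _ ≤ ∑ _i : Fin n, (1 : ℝ) := Finset.sum_le_sum fun i _ =>
          (variance_le_sq_of_bounded (ae_of_all _ hbdd) hmeas.aemeasurable).trans (by norm_num)
      _ = n := by simp
  have hcheb := meas_ge_le_variance_div_sq hZL (mul_pos hn' hη)
  rw [hmean] at hcheb
  refine (measure_mono fun x hx => ?_).trans (hcheb.trans (ENNReal.ofReal_le_ofReal ?_))
  · have hx' : η ≤ |p.1.real S - empFreq S x| := hx
    have : Z x - n * p.1.real S = -(n * (p.1.real S - empFreq S x)) := by
      rw [hZapp, empFreq]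
      field_simp
      ring
    rw [Set.mem_ofPred_eq, this, abs_neg, abs_mul, abs_of_pos hn']
    gcongr
  · calc _ ≤ (n : ℝ) / (n * η) ^ 2 := by gcongr
      _ = _ := by field_simp

/-! ### Minimum distance estimation over a finite family -/

section MinDistance

variable {ι κ : Type*} [Fintype ι] [Fintype κ]

/-- The largest discrepancy between `q` and the empirical frequencies on the sets `S k`. -/
def discrepancy (S : κ → Set X) (q : Distribution X) {n : ℕ} (x : Fin n → X) : ℝ :=
  ⨆ k, |q.1.real (S k) - empFreq (S k) x|

lemma measurable_discrepancy {S : κ → Set X} (hS : ∀ k, MeasurableSet (S k))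
    (q : Distribution X) (n : ℕ) : Measurable (discrepancy S q (n := n)) :=
  .iSup fun k => by
    simp only [← Real.norm_eq_abs]
    exact (measurable_const.sub (measurable_empFreq (hS k))).norm

lemma le_discrepancy (S : κ → Set X) (q : Distribution X) {n : ℕ} (x : Fin n → X) (k : κ) :
    |q.1.real (S k) - empFreq (S k) x| ≤ discrepancy S q x :=
  le_ciSup (f := fun k => |q.1.real (S k) - empFreq (S k) x|) (Set.finite_range _).bddAbove k

lemma discrepancy_le_add [Nonempty κ] (S : κ → Set X) (q : Distribution X) {n : ℕ}
    {x x' : Fin n → X} (h : Neighbors x x') :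
    discrepancy S q x ≤ discrepancy S q x' + 1 / n := by
  refine ciSup_le fun k => ?_
  have h1 := abs_sub_le (q.1.real (S k)) (empFreq (S k) x') (empFreq (S k) x)
  have h2 := h.abs_empFreq_sub_le (S k)
  rw [abs_sub_comm] at h2
  linarith [le_discrepancy S q x' k]

lemma Neighbors.symm {X : Type*} {n : ℕ} {x x' : Fin n → X} (h : Neighbors x x') : Neighbors x' x :=
  h.imp fun _ hi j hj => (hi j hj).symm

/-- A supremum does not increase sensitivity, so the privacy cost is independent of the number of
sets. -/
lemma abs_discrepancy_sub_le [Nonempty κ] (S : κ → Set X) (q : Distribution X) {n : ℕ}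
    {x x' : Fin n → X} (h : Neighbors x x') :
    |discrepancy S q x - discrepancy S q x'| ≤ 1 / n := by
  rw [abs_sub_le_iff]
  constructor
  · linarith [discrepancy_le_add S q h]
  · linarith [discrepancy_le_add S q h.symm]

/-- Approximate minimisers of the discrepancy are `3`-robust. -/
lemma tvDist_le_of_discrepancy_le [Nonempty ι] {q : ι → Distribution X} {S : ι × ι → Set X}
    (hS : ∀ k, MeasurableSet (S k)) {η a : ℝ}
    (hSq : ∀ i j, tvDist (q i) (q j) ≤ |(q i).1.real (S (i, j)) - (q j).1.real (S (i, j))| + η)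
    {p : Distribution X} {n : ℕ} {x : Fin n → X}
    (hx : ∀ k, |p.1.real (S k) - empFreq (S k) x| ≤ η) {i i₀ : ι}
    (hi : discrepancy S (q i) x ≤ discrepancy S (q i₀) x + a) :
    tvDist p (q i) ≤ 3 * tvDist p (q i₀) + (3 * η + a) := by
  have h0 : discrepancy S (q i₀) x ≤ tvDist p (q i₀) + η := ciSup_le fun k => by
    have h1 := abs_sub_le ((q i₀).1.real (S k)) (p.1.real (S k)) (empFreq (S k) x)
    have h2 := abs_sub_le_tvDist (q i₀) p (hS k)
    rw [tvDist_comm] at h2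
    linarith [hx k]
  -- The first leg counts once. The set `S (i, i₀)` bounds the second by two discrepancies plus `η`,
  -- hence by `2 * tvDist p (q i₀)` plus `3 * η + a`.
  have h1 := tvDist_triangle p (q i₀) (q i)
  rw [tvDist_comm (q i₀)] at h1
  have h2 := abs_sub_le ((q i).1.real (S (i, i₀))) (empFreq (S (i, i₀)) x)
    ((q i₀).1.real (S (i, i₀)))
  have h3 := le_discrepancy S (q i) x (i, i₀)
  have h4 := le_discrepancy S (q i₀) x (i, i₀)
  rw [abs_sub_comm] at h4
  linarith [hSq i i₀]

/-- The sample deviates on one of finitely many sets with small probability. -/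
lemma measure_exists_deviation_le (p : Distribution X) {n : ℕ} (hn : 0 < n) {S : κ → Set X}
    (hS : ∀ k, MeasurableSet (S k)) {η : ℝ} (hη : 0 < η) :
    haveI := p.2
    (Measure.pi fun _ : Fin n => p.1) {x | ∃ k, η ≤ |p.1.real (S k) - empFreq (S k) x|} ≤
      ENNReal.ofReal (Fintype.card κ / (n * η ^ 2)) := by
  have := p.2
  rw [Set.ofPred_exists]
  refine (measure_iUnion_fintype_le _ _).trans ?_
  calc _ ≤ ∑ _k : κ, ENNReal.ofReal (1 / (n * η ^ 2)) :=
        Finset.sum_le_sum fun k _ => measure_empFreq_deviation_le p hn (hS k) hη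
    _ = _ := by
        rw [div_eq_mul_one_div (Fintype.card κ : ℝ), ENNReal.ofReal_mul (by positivity)]
        simp

end MinDistance

/-- If `K` does well on every sample outside a small set, then it does well on average. -/
lemma le_lintegral_of_le_on {Ω : Type*} [MeasurableSpace Ω] {μ : Measure Ω}
    [IsProbabilityMeasure μ] {f : Ω → ENNReal} {G : Set Ω} (hG : MeasurableSet G) {b c : ℝ}
    (hb : 0 ≤ b) (hc : 0 ≤ c) (hGc : μ Gᶜ ≤ ENNReal.ofReal b)
    (hf : ∀ x ∈ G, ENNReal.ofReal (1 - c) ≤ f x) :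
    ENNReal.ofReal (1 - (b + c)) ≤ ∫⁻ x, f x ∂μ := by
  rcases le_or_gt 1 (b + c) with h | h
  · rw [ENNReal.ofReal_of_nonpos (by linarith)]
    exact zero_le
  have hμG : ENNReal.ofReal (1 - b) ≤ μ G := by
    rw [ENNReal.ofReal_sub _ hb, ENNReal.ofReal_one, tsub_le_iff_right, ← prob_add_prob_compl (μ := μ) hG]
    gcongr
  calc ENNReal.ofReal (1 - (b + c)) ≤ ENNReal.ofReal ((1 - c) * (1 - b)) :=
        ENNReal.ofReal_le_ofReal (by nlinarith [mul_nonneg hb hc])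
    _ = ENNReal.ofReal (1 - c) * ENNReal.ofReal (1 - b) := ENNReal.ofReal_mul (by linarith)
    _ ≤ ENNReal.ofReal (1 - c) * μ G := by gcongr
    _ = ∫⁻ _ in G, ENNReal.ofReal (1 - c) ∂μ := by simp
    _ ≤ ∫⁻ x in G, f x ∂μ := setLIntegral_mono' hG hf
    _ ≤ ∫⁻ x, f x ∂μ := setLIntegral_le_lintegral _ _

/-- `K` is an `ε`-private kernel on samples of size `n` that learns every distribution `c`-robustly
up to `α`, except with probability `β`. -/
def IsRobustAt (c : ℝ) (Q : Set (Distribution X)) (α β ε : ℝ) {n : ℕ}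
    (K : Kernel (Fin n → X) (Distribution X)) : Prop :=
  IsDP K ε 0 ∧ ∀ p : Distribution X,
    haveI := p.2
    ENNReal.ofReal (1 - β) ≤
      ((Measure.pi fun _ : Fin n => p.1).bind K) {q | tvDist p q ≤ c * tvDistTo p Q + α}

lemma IsRobustAt.mono {c : ℝ} {Q : Set (Distribution X)} {α β ε α' β' ε' : ℝ} {n : ℕ}
    {K : Kernel (Fin n → X) (Distribution X)} (h : IsRobustAt c Q α β ε K)
    (hα : α ≤ α') (hβ : β ≤ β') (hε : ε ≤ ε') : IsRobustAt c Q α' β' ε' K := by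
  refine ⟨fun x x' hx B hB => (h.1 x x' hx B hB).trans ?_, fun p => ?_⟩
  · gcongr
  · refine (ENNReal.ofReal_le_ofReal (by linarith)).trans ((h.2 p).trans (measure_mono ?_))
    intro q hq
    exact le_trans (b := c * tvDistTo p Q + α) hq (by linarith)

/-- A finite cover yields private robust learners for all large sample sizes. -/
lemma exists_isRobustAt {Q : Set (Distribution X)} (hQ : Q.Nonempty) (h : PureDPLearnable Q)
    {α β ε : ℝ} (hα : α ∈ Set.Ioo (0 : ℝ) 1) (hβ : 0 < β) (hε : 0 < ε) :
    ∃ N : ℕ, ∀ n ≥ N, ∃ K : Kernel (Fin n → X) (Distribution X),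
      IsMarkovKernel K ∧ IsRobustAt 3 Q α β ε K := by
  -- Error budget: `3 * 2η` from the near-infimum and the cover, `3η` from sampling and near-Scheffé
  -- sets, `3η` from the mechanism.
  set η := α / 12 with hη
  have hη0 : 0 < η := by linarith [hα.1]
  obtain ⟨T, hT⟩ := h.exists_finset_cover (r := η) ⟨hη0, by linarith [hα.1, hα.2]⟩
  have : Nonempty T := by
    obtain ⟨p, hp⟩ := hQ
    obtain ⟨q, hq, -⟩ := hT p hp
    exact ⟨⟨q, hq⟩⟩
  choose S hSm hSd using fun k : T × T => exists_tvDist_le_add k.1.1 k.2.1 hη0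
  set q : T → Distribution X := Subtype.val
  have lim₁ : Filter.Tendsto (fun n : ℕ => (Fintype.card (T × T) : ℝ) / (n * η ^ 2))
      Filter.atTop (nhds 0) :=
    Filter.Tendsto.const_div_atTop
      (tendsto_natCast_atTop_atTop.atTop_mul_const (by positivity)) _
  have lim₂ : Filter.Tendsto
      (fun n : ℕ => (Fintype.card T : ℝ) * Real.exp (-(n * (ε / 2 * (3 * η)))))
      Filter.atTop (nhds 0) := by
    simpa using (Real.tendsto_exp_neg_atTop_nhds_zero.comp
      (tendsto_natCast_atTop_atTop.atTop_mul_const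
        (show 0 < ε / 2 * (3 * η) by positivity))).const_mul (Fintype.card T : ℝ)
  obtain ⟨N, hN⟩ := Filter.eventually_atTop.1
    (((lim₁.eventually (gt_mem_nhds (half_pos hβ))).and
      (lim₂.eventually (gt_mem_nhds (half_pos hβ)))).and (Filter.eventually_gt_atTop 0))
  refine ⟨N, fun n hn => ?_⟩
  obtain ⟨⟨hdev, hexp⟩, hn0⟩ := hN n hn
  have hn' : (0 : ℝ) < n := by exact_mod_cast hn0
  -- This scaling turns sensitivity `1 / n` into the `ε / 2` needed for `ε`-privacy.
  let s : T → (Fin n → X) → ℝ := fun i x => n * (ε / 2) * discrepancy S (q i) x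
  have hs : ∀ i, Measurable (s i) := fun i => (measurable_discrepancy hSm (q i) n).const_mul _
  refine ⟨expMechanism s hs q, isMarkovKernel_expMechanism s hs q,
    isDP_expMechanism hs q fun x x' hx i => ?_, fun p => ?_⟩
  · have := abs_discrepancy_sub_le S (q i) hx
    simp only [s]
    rw [← mul_sub, abs_mul, abs_of_pos (by positivity)]
    calc _ ≤ n * (ε / 2) * (1 / n) := by gcongr
      _ = ε / 2 := by field_simp
  have := p.2
  obtain ⟨p', hp'Q, hp'⟩ := exists_tvDist_lt_tvDistTo_add hQ p hη0
  obtain ⟨q₀, hq₀T, hq₀⟩ := hT p' hp'Q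
  have hopt : tvDist p q₀ ≤ tvDistTo p Q + 2 * η := by linarith [tvDist_triangle p p' q₀]
  have hB := measurableSet_tvDist_le p (3 * tvDistTo p Q + α)
  rw [Measure.bind_apply hB (Kernel.aemeasurable _)]
  have hbad : MeasurableSet {x : Fin n → X | ∃ k, η ≤ |p.1.real (S k) - empFreq (S k) x|} := by
    rw [Set.ofPred_exists]
    refine MeasurableSet.iUnion fun k => measurableSet_le measurable_const ?_
    simp only [← Real.norm_eq_abs]
    exact (measurable_const.sub (measurable_empFreq (hSm k))).norm
  rw [show (1 - β) = 1 - (β / 2 + β / 2) by ring]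
  refine le_lintegral_of_le_on hbad.compl (half_pos hβ).le (half_pos hβ).le ?_ fun x hx => ?_
  · rw [compl_compl]
    exact (measure_exists_deviation_le p hn0 hSm hη0).trans (ENNReal.ofReal_le_ofReal hdev.le)
  · have hx' : ∀ k, |p.1.real (S k) - empFreq (S k) x| ≤ η := fun k => by
      by_contra! hk
      exact hx ⟨k, hk.le⟩
    refine (ENNReal.ofReal_le_ofReal (sub_le_sub_left hexp.le 1)).trans
      (le_expMechanism_apply hs q hB (i₀ := ⟨q₀, hq₀T⟩) fun i => ?_)
    rw [or_iff_not_imp_right]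
    intro hi
    have hdisc : discrepancy S (q i) x ≤ discrepancy S (q ⟨q₀, hq₀T⟩) x + 3 * η := by
      by_contra! hlt
      refine hi ?_
      have := mul_le_mul_of_nonneg_left hlt.le (show 0 ≤ n * (ε / 2) by positivity)
      simp only [s]
      linarith
    have := tvDist_le_of_discrepancy_le hSm (fun i j => hSd (i, j)) hx' hdisc
    change tvDist p (q i) ≤ _
    have h0 : tvDist p (q ⟨q₀, hq₀T⟩) ≤ tvDistTo p Q + 2 * η := hopt
    linarith

/-- One learner that serves all parameters: run, on samples of size `n`, the mechanism for the
best accuracy that `n` samples allow. -/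
lemma pureDPRobustlyLearnable_of_forall_isRobustAt {c : ℝ} {Q : Set (Distribution X)}
    (hQ : Q.Nonempty)
    (h : ∀ k : ℕ, ∃ N : ℕ, ∀ n ≥ N, ∃ K : Kernel (Fin n → X) (Distribution X),
      IsMarkovKernel K ∧ IsRobustAt c Q (1 / (k + 2)) (1 / (k + 2)) (1 / (k + 2)) K) :
    PureDPRobustlyLearnable c Q := by
  classical
  obtain ⟨q₀, -⟩ := hQ
  choose N hN using h
  -- The default level 0 may fail the condition when `n` is small; a constant kernel is used then.
  let level : ℕ → ℕ := fun n => Nat.findGreatest (fun k => N k ≤ n) n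
  have hker : ∀ n, ∃ K : Kernel (Fin n → X) (Distribution X), IsMarkovKernel K ∧
      (N (level n) ≤ n → IsRobustAt c Q (1 / (level n + 2)) (1 / (level n + 2))
        (1 / (level n + 2)) K) := by
    intro n
    by_cases hn : N (level n) ≤ n
    · obtain ⟨K, hK, hKr⟩ := hN (level n) n hn
      exact ⟨K, hK, fun _ => hKr⟩
    · exact ⟨Kernel.const _ (Measure.dirac q₀), inferInstance, fun hn' => absurd hn' hn⟩
  choose K hK hKr using hker
  -- The first entry of the maximum is there because `level n` only searches up to `n`.
  refine ⟨⟨K, hK⟩, fun α β ε => max ⌈1 / min α (min β ε)⌉₊ (N ⌈1 / min α (min β ε)⌉₊), ?_⟩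
  intro p α hα β hβ ε hε n hn
  set k := ⌈1 / min α (min β ε)⌉₊
  have hkn : k ≤ n := (le_max_left _ _).trans hn
  have hNk : N k ≤ n := (le_max_right _ _).trans hn
  have hspec : N (level n) ≤ n := Nat.findGreatest_spec (P := fun k => N k ≤ n) hkn hNk
  have hlevel : k ≤ level n := Nat.le_findGreatest hkn hNk
  have hmin : 0 < min α (min β ε) := lt_min hα.1 (lt_min hβ.1 hε.1)
  have hle : (1 : ℝ) / (level n + 2) ≤ min α (min β ε) := by
    have h1 : 1 / min α (min β ε) ≤ k := Nat.le_ceil _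
    have h2 : (k : ℝ) ≤ level n := by exact_mod_cast hlevel
    rw [div_le_iff₀ (by positivity)]
    rw [div_le_iff₀ hmin] at h1
    nlinarith
  have := (hKr n hspec).mono (hle.trans (min_le_left _ _))
    (hle.trans ((min_le_right _ _).trans (min_le_left _ _)))
    (hle.trans ((min_le_right _ _).trans (min_le_right _ _)))
  exact ⟨this.1, this.2 p⟩

end DPRobust

end

theorem mainTheorem8 {X : Type*} [MeasurableSpace X] (Q : Set (DPRobust.Distribution X))
    (hQ : Q.Nonempty) (h : DPRobust.PureDPLearnable Q) :
    DPRobust.PureDPRobustlyLearnable 3 Q := by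
  refine DPRobust.pureDPRobustlyLearnable_of_forall_isRobustAt hQ fun k => ?_
  have hpos : (0 : ℝ) < 1 / (k + 2) := by positivity
  -- The shift by 2 keeps the accuracy strictly below 1 even at `k = 0`.
  have hlt : (1 : ℝ) / (k + 2) < 1 := by
    rw [div_lt_one (by positivity)]
    linarith [(Nat.cast_nonneg k : (0 : ℝ) ≤ k)]
  exact DPRobust.exists_isRobustAt hQ h ⟨hpos, hlt⟩ hpos hpos
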